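/- Let $\mathcal A$ be a locally finitely presentable category in which every morphism factors as a regular epimorphism followed by a monomorphism. Let $\mathbb T=(T,\eta,\mu)$ be a monad on $\mathcal A$ which is finitary ($T$ preserves filtered colimits) and regular ($T$ preserves regular epimorphisms), and let $\mathcal A^{\mathbb T}$ be its category of Eilenberg–Moore algebras. For every $\mathbb T$-algebra $(A,a)$ the following conditions are equivalent: 1. $(A,a)$ is a quotient of a free algebra $(TX,\mu_X)$, with $X$ finitely presentable in $\mathcal A$, modulo a finitely generated congruence; that is, there are a finitely generated congruence $\ell,r\colon (K,k)\rightrightarrows (TX,\mu_X)$ and a coequalizer $q\colon (TX,\mu_X)\to(A,a)$ of $\ell,r$ in $\mathcal A^{\mathbb T}$; 2. $(A,a)$ is a coequalizer in $\mathcal A^{\mathbb T}$ of a parallel pair of $\mathbb T$-algebra morphisms $f,g\colon (TY,\mu_Y)\rightrightarrows (TX,\mu_X)$ with $X$ and $Y$ finitely presentable in $\mathcal A$; 3. $(A,a)$ is a finitely presentable object of $\mathcal A^{\mathbb T}$. Here an object is finitely presentable if its hom-functor preserves filtered colimits, and finitely generated if its hom-functor preserves colimits of those filtered diagrams all of whose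 connecting morphisms are monic. A congruence on an algebra $(B,b)$ is a subalgebra of $(B,b)\times(B,b)$, given by a pair $\ell,r\colon (K,k)\rightrightarrows (B,b)$, that is a kernel pair of some $\mathbb T$-algebra morphism. It is finitely generated if there is a monomorphism $m\colon (K',k')\to (K,k)$ in $\mathcal A^{\mathbb T}$, with $(K',k')$ a finitely generated object of $\mathcal A^{\mathbb T}$, such that the coequalizer of $\ell,r$ in $\mathcal A^{\mathbb T}$ is also a coequalizer of $\ell\cdot m$ and $r\cdot m$. -/

import Mathlib

universe v u

open CategoryTheory CategoryTheory.Limits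

namespace RegularMonadAlgebras

/-- An object `X` is *finitely generated* if its hom-functor preserves (small) filtered colimits of
monomorphisms, i.e. colimits of those filtered diagrams all of whose connecting morphisms
are monic. -/
def IsFinitelyGeneratedObject {C : Type u} [Category.{v} C] (X : C) : Prop :=
  ∀ (J : Type v) [SmallCategory J] [IsFiltered J] (D : J ⥤ C),
    (∀ ⦃i j : J⦄ (h : i ⟶ j), Mono (D.map h)) →
      PreservesColimit D (coyoneda.obj (Opposite.op X))

/-- `q` is a coequalizer of the parallel pair `f, g`. -/
def IsCoequalizer {C : Type u} [Category.{v} C] {X Y Z : C} (f g : X ⟶ Y) (q : Y ⟶ Z) : Prop :=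
  ∃ w : f ≫ q = g ≫ q, Nonempty (IsColimit (Cofork.ofπ q w))

/-- The category has regular factorizations: every morphism is a regular epimorphism followed by a
monomorphism. -/
def HasRegularFactorizations (C : Type u) [Category.{v} C] : Prop :=
  ∀ ⦃X Y : C⦄ (f : X ⟶ Y), ∃ (I : C) (e : X ⟶ I) (m : I ⟶ Y),
    IsRegularEpi e ∧ Mono m ∧ e ≫ m = f

section Monad

variable {C : Type u} [Category.{v} C]

/-- A monad is *finitary* if its underlying functor preserves filtered colimits. -/
def IsFinitaryMonad (T : Monad C) : Prop :=
  PreservesFilteredColimitsOfSize.{v, v} T.toFunctor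

/-- A monad is *regular* if its underlying functor preserves regular epimorphisms. -/
def IsRegularMonad (T : Monad C) : Prop :=
  ∀ ⦃X Y : C⦄ (f : X ⟶ Y), IsRegularEpi f → IsRegularEpi (T.map f)

variable {T : Monad C}

/-- A *congruence* on a `T`-algebra `A`: a parallel pair `l, r : K ⟶ A` which is a kernel pair of
some `T`-algebra morphism. (Such a pair is jointly monic, so it represents a subalgebra
of `A × A`.) -/
def IsCongruence {K A : T.Algebra} (l r : K ⟶ A) : Prop :=
  ∃ (B : T.Algebra) (f : A ⟶ B), IsKernelPair f l r

/-- A congruence `l, r : K ⟶ A` is *finitely generated* if there is a finitely generated subalgebra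
`m : K' ⟶ K` such that the quotient `q : A ⟶ B` of `A` modulo `K`, i.e. the coequalizer of `l` and
`r`, is also a coequalizer of `m ≫ l` and `m ≫ r`. -/
def IsFinitelyGeneratedCongruence {K A : T.Algebra} (l r : K ⟶ A) : Prop :=
  IsCongruence l r ∧
    ∃ (K' : T.Algebra) (m : K' ⟶ K), IsFinitelyGeneratedObject K' ∧ Mono m ∧
      ∃ (B : T.Algebra) (q : A ⟶ B), IsCoequalizer l r q ∧ IsCoequalizer (m ≫ l) (m ≫ r) q

end Monad

end RegularMonadAlgebras

namespace RegularMonadAlgebras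

-- Since `T` preserves regular epimorphisms, image factorizations lift to algebras. A finitely
-- generated algebra is a filtered colimit of images of free algebras on finitely presentable
-- objects, so it equals one of them (`exists_cover_of_isFinitelyGeneratedObject`). Covering the
-- generators of a congruence gives 1 → 2; taking the image of a pair in the kernel pair gives 2 →
-- 1. Free algebras on finitely presentable objects are finitely presentable, hence 2 → 3. For 3 →
-- 2, cover `A` by a free algebra; the cover is the coequalizer of its kernel pair, which is tested
-- by free algebras on a filtered diagram of finitely presentable objects. By
-- `exists_coequalizer_of_filtered`, one stage suffices. That lemma needs only products and filtered
-- colimits of algebras, not coequalizers.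

attribute [local instance] Cardinal.fact_isRegular_aleph0

/-! ### Limits and presentations in locally finitely presentable categories -/

section LocallyFinitelyPresentable

variable (C : Type u) [Category.{v} C] [IsLocallyFinitelyPresentable.{v} C]

theorem hasColimits_of_isLocallyFinitelyPresentable : HasColimitsOfSize.{v, v} C :=
  IsCardinalLocallyPresentable.toHasColimitsOfSize Cardinal.aleph0

/-- A locally finitely presentable category is reflective in presheaves on its finitely
presentable objects, hence complete. -/
theorem hasLimits_of_isLocallyFinitelyPresentable : HasLimitsOfSize.{v, v} C := by
  have := hasColimits_of_isLocallyFinitelyPresentable C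
  let P := ObjectProperty.isFinitelyPresentable.{v} C
  have : EssentiallySmall.{v} P.FullSubcategory := inferInstance
  let F : SmallModel.{v} P.FullSubcategory ⥤ C := (equivSmallModel.{v} _).inverse ⋙ P.ι
  have : F.IsDense := inferInstance
  let R := Presheaf.restrictedULiftYoneda.{v} F
  let L : (_ ⥤ Type v) ⥤ C := uliftYoneda.{v}.leftKanExtension F
  let adj : L ⊣ R := Presheaf.uliftYonedaAdjunction.{v} L (uliftYoneda.{v}.leftKanExtensionUnit F)
  let _ : Reflective R := { L := L, adj := adj }
  exact hasLimits_of_reflective R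

variable {C}

theorem exists_finitelyPresentable_presentation (X : C) :
    ∃ (J : Type v) (_ : SmallCategory J) (_ : IsFiltered J) (p : ColimitPresentation J X),
      ∀ j, IsFinitelyPresentable.{v} (p.diag.obj j) := by
  obtain ⟨J, _, hJ, ⟨p⟩⟩ := (isCardinalFilteredGenerator_isCardinalPresentable C
    Cardinal.aleph0.{v}).exists_colimitsOfShape X
  exact ⟨J, inferInstance, isFiltered_of_isCardinalFiltered J Cardinal.aleph0.{v},
    p.toColimitPresentation, p.prop_diag_obj⟩

theorem hom_ext_finitelyPresentable {X Y : C} {f g : X ⟶ Y}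
    (h : ∀ (P : C) (t : P ⟶ X), IsFinitelyPresentable.{v} P → t ≫ f = t ≫ g) : f = g := by
  obtain ⟨J, _, _, p, hp⟩ := exists_finitelyPresentable_presentation X
  exact p.isColimit.hom_ext fun j => h _ _ (hp j)

/-- A filtered family of subobjects of `X` through which a presentation of `X` by finitely
presentable objects factors has colimit `X`. -/
theorem isColimit_of_mono_of_presentation {J : Type v} [SmallCategory J] [IsFiltered J] {X : C}
    (p : ColimitPresentation J X) (S : J ⥤ C) (c : S ⟶ (Functor.const J).obj X)
    (hc : ∀ j, Mono (c.app j)) (σ : ∀ j, p.diag.obj j ⟶ S.obj j)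
    (hσ : ∀ j, σ j ≫ c.app j = p.ι.app j) :
    Nonempty (IsColimit (Cocone.mk X c)) := by
  have hw {i j : J} (u : i ⟶ j) : S.map u ≫ c.app j = c.app i := by simp
  let τ : p.diag ⟶ S :=
    { app := σ
      naturality := fun i j u => by
        rw [← cancel_mono (c.app j), Category.assoc, Category.assoc, hσ, hw, hσ, p.w] }
  have key (s : Cocone S) (i : J) :
      c.app i ≫ p.isColimit.desc ⟨s.pt, τ ≫ s.ι⟩ = s.ι.app i := by
    refine hom_ext_finitelyPresentable fun Q a hQ => ?_
    obtain ⟨j, b, hb⟩ := IsFinitelyPresentable.exists_hom_of_isColimit p.isColimit (a ≫ c.app i)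
    have hd := p.isColimit.fac ⟨s.pt, τ ≫ s.ι⟩ j
    dsimp at hb hd
    obtain ⟨k, u, v, -⟩ := IsFilteredOrEmpty.cocone_objs i j
    -- Both sides agree after the monomorphism into `X`, so the chosen factorization through `p`
    -- does not matter.
    have h₁ : a ≫ S.map u = b ≫ σ j ≫ S.map v := by
      rw [← cancel_mono (c.app k), Category.assoc, Category.assoc, Category.assoc, hw, hw, hσ, hb]
    rw [← reassoc_of% hb, hd]
    change b ≫ σ j ≫ s.ι.app j = _
    rw [← s.w u, ← s.w v, reassoc_of% h₁]
  exact ⟨{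
    desc := fun s => p.isColimit.desc ⟨s.pt, τ ≫ s.ι⟩
    fac := key
    uniq := fun s m hm => p.isColimit.hom_ext fun j => by
      have hd := p.isColimit.fac ⟨s.pt, τ ≫ s.ι⟩ j
      have hm' := hm j
      dsimp at hd hm' ⊢
      rw [hd, ← hσ, Category.assoc, hm'] }⟩

end LocallyFinitelyPresentable

/-! ### Coequalizers and kernel pairs -/

section Coequalizer

variable {C : Type u} [Category.{v} C] {X Y Z : C} {f g : X ⟶ Y} {q : Y ⟶ Z}

theorem IsCoequalizer.exists_desc (h : IsCoequalizer f g q) {W : C} (k : Y ⟶ W)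
    (hk : f ≫ k = g ≫ k) : ∃ d : Z ⟶ W, q ≫ d = k := by
  obtain ⟨_, ⟨hq⟩⟩ := h
  exact ⟨Cofork.IsColimit.desc hq k hk, Cofork.IsColimit.π_desc' hq k hk⟩

theorem IsCoequalizer.epi (h : IsCoequalizer f g q) : Epi q := by
  obtain ⟨_, ⟨hq⟩⟩ := h
  exact epi_of_isColimit_cofork hq

theorem isCoequalizer_of_exists_desc [Epi q] (w : f ≫ q = g ≫ q)
    (h : ∀ {W : C} (k : Y ⟶ W), f ≫ k = g ≫ k → ∃ d : Z ⟶ W, q ≫ d = k) :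
    IsCoequalizer f g q := by
  refine ⟨w, ⟨Cofork.IsColimit.mk' _ fun s => ?_⟩⟩
  have hs := h s.π s.condition
  refine ⟨hs.choose, hs.choose_spec, fun {m} hm => ?_⟩
  rw [← cancel_epi q]
  exact hm.trans hs.choose_spec.symm

/-- The coequalizer of a pair is the coequalizer of any other pair that is coequalized by the same
morphisms. -/
theorem IsCoequalizer.of_iff (h : IsCoequalizer f g q) {X' : C} {f' g' : X' ⟶ Y}
    (H : ∀ {W : C} (k : Y ⟶ W), f' ≫ k = g' ≫ k ↔ f ≫ k = g ≫ k) : IsCoequalizer f' g' q :=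
  have := h.epi
  isCoequalizer_of_exists_desc ((H q).2 h.1) fun k hk => h.exists_desc k ((H k).1 hk)

theorem isCoequalizer_of_isKernelPair (h : IsCoequalizer f g q) {K : C}
    {l r : K ⟶ Y} (hK : IsKernelPair q l r) : IsCoequalizer l r q := by
  have := h.epi
  refine isCoequalizer_of_exists_desc hK.w fun k hk => h.exists_desc k ?_
  have := hK.lift f g h.1 ≫= hk
  rwa [hK.lift_fst_assoc, hK.lift_snd_assoc] at this

end Coequalizer

/-! ### Free algebras and image factorizations -/

section Algebra

variable {C : Type u} [Category.{v} C] {T : Monad C}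

/-- The extension of a morphism to an algebra along the unit of the monad. -/
def freeLift {P : C} {A : T.Algebra} (t : P ⟶ A.A) : T.free.obj P ⟶ A :=
  (T.adj.homEquiv P A).symm t

/-- The restriction of a morphism from a free algebra along the unit of the monad. -/
def freeRestrict {P : C} {A : T.Algebra} (x : T.free.obj P ⟶ A) : P ⟶ A.A :=
  T.adj.homEquiv P A x

theorem freeRestrict_freeLift {P : C} {A : T.Algebra} (t : P ⟶ A.A) :
    freeRestrict (freeLift t) = t :=
  (T.adj.homEquiv P A).apply_symm_apply t

theorem freeRestrict_comp {P : C} {A B : T.Algebra} (x : T.free.obj P ⟶ A) (y : A ⟶ B) :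
    freeRestrict (x ≫ y) = freeRestrict x ≫ y.f :=
  T.adj.homEquiv_naturality_right x y

theorem free_map_freeLift {P Q : C} {A : T.Algebra} (w : P ⟶ Q) (t : Q ⟶ A.A) :
    T.free.map w ≫ freeLift t = freeLift (w ≫ t) :=
  (T.adj.homEquiv_naturality_left_symm w t).symm

theorem freeLift_hom_ext {P : C} {A B : T.Algebra} {t : P ⟶ A.A} {x y : A ⟶ B}
    (h : freeLift t ≫ x = freeLift t ≫ y) : t ≫ x.f = t ≫ y.f := by
  rw [← freeRestrict_freeLift t, ← freeRestrict_comp, h, freeRestrict_comp]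

theorem mono_f {A B : T.Algebra} (m : A ⟶ B) [Mono m] : Mono m.f :=
  inferInstanceAs (Mono (T.forget.map m))

/-- A morphism of algebras carried by a strong epimorphism is orthogonal to monomorphisms. -/
theorem exists_algebra_lift {A B M N : T.Algebra} (e : A ⟶ B) [StrongEpi e.f] (m : M ⟶ N)
    [Mono m] (s : A ⟶ M) (t : B ⟶ N) (w : s ≫ m = e ≫ t) : ∃ d : B ⟶ M, d ≫ m = t := by
  have := mono_f m
  have sq : CommSq s.f e.f m.f t.f := ⟨congrArg Monad.Algebra.Hom.f w⟩
  refine ⟨⟨sq.lift, ?_⟩, ?_⟩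
  · rw [← cancel_mono m.f, Category.assoc, Category.assoc, ← m.h, ← Functor.map_comp_assoc,
      sq.fac_right, t.h]
  · ext
    exact sq.fac_right

/-- Regular factorizations lift to the algebras for a regular monad. -/
theorem exists_algebra_factorization (hC : HasRegularFactorizations C) (hreg : IsRegularMonad T)
    {A B : T.Algebra} (h : A ⟶ B) : ∃ (I : T.Algebra) (e : A ⟶ I) (m : I ⟶ B),
      IsRegularEpi e.f ∧ Mono m ∧ e ≫ m = h := by
  obtain ⟨I, e, m, he, hm, hem⟩ := hC h.f
  have := hreg e he
  -- `T.map e` is a regular, hence strong, epimorphism; the diagonal is the algebra structure on the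
  -- image.
  have sq : CommSq (A.a ≫ e) (T.map e) m (T.map m ≫ B.a) := ⟨by
    rw [Category.assoc, hem, ← h.h, ← Functor.map_comp_assoc, hem]⟩
  have hl := sq.fac_right
  let I' : T.Algebra :=
    { A := I
      a := sq.lift
      unit := by
        rw [← cancel_mono m, Category.assoc, hl, ← T.η.naturality_assoc, B.unit]
        simp
      assoc := by
        rw [← cancel_mono m, Category.assoc, Category.assoc, hl, ← T.μ.naturality_assoc, B.assoc,
          ← Functor.map_comp_assoc, hl]
        simp }
  let m' : I' ⟶ B := ⟨m, hl.symm⟩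
  have : Mono m'.f := hm
  exact ⟨I', ⟨e, sq.fac_left⟩, m', he, T.algebra_mono_of_mono m', by ext; exact hem⟩

/-- A morphism of algebras carried by a regular epimorphism that the monad preserves is the
coequalizer of its kernel pair. -/
theorem isCoequalizer_of_isRegularEpi_f (hreg : IsRegularMonad T) {A B K : T.Algebra} (q : A ⟶ B)
    [IsRegularEpi q.f] {l r : K ⟶ A} (hK : IsKernelPair q l r) : IsCoequalizer l r q := by
  have hKC : IsKernelPair q.f l.f r.f := hK.map T.forget
  have := hreg q.f inferInstance
  have : Epi q := T.algebra_epi_of_epi q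
  refine isCoequalizer_of_exists_desc hK.w fun {W} k hk => ?_
  have hkC : l.f ≫ k.f = r.f ≫ k.f := congrArg Monad.Algebra.Hom.f hk
  let d := Cofork.IsColimit.desc hKC.toCoequalizer' k.f hkC
  have hd : q.f ≫ d = k.f := Cofork.IsColimit.π_desc' hKC.toCoequalizer' k.f hkC
  refine ⟨⟨d, ?_⟩, by ext; exact hd⟩
  rw [← cancel_epi (T.map q.f), ← Functor.map_comp_assoc, hd, k.h, q.h_assoc, hd]

end Algebra

/-! ### Finiteness conditions on algebras -/

section FinitaryMonad

variable {C : Type u} [Category.{v} C] [IsLocallyFinitelyPresentable.{v} C] {T : Monad C}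

theorem hasLimits_algebra : HasLimitsOfSize.{v, v} T.Algebra := by
  have := hasLimits_of_isLocallyFinitelyPresentable C
  exact ⟨fun J _ => ⟨fun D => Monad.hasLimit_of_comp_forget_hasLimit D⟩⟩

theorem hasFilteredColimits_algebra (hfin : IsFinitaryMonad T) (J : Type v) [SmallCategory J]
    [IsFiltered J] : HasColimitsOfShape J T.Algebra := by
  have := hasColimits_of_isLocallyFinitelyPresentable C
  have : PreservesFilteredColimitsOfSize.{v, v} T.toFunctor := hfin
  have : PreservesColimitsOfShape J T.toFunctor :=
    PreservesFilteredColimitsOfSize.preserves_filtered_colimits J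
  exact ⟨fun D => Monad.forget_creates_colimits_of_monad_preserves D⟩

theorem isFinitelyPresentable_free (hfin : IsFinitaryMonad T) (X : C)
    [IsFinitelyPresentable.{v} X] : IsFinitelyPresentable.{v} (T.free.obj X) := by
  have := hasColimits_of_isLocallyFinitelyPresentable C
  have : PreservesFilteredColimitsOfSize.{v, v} T.toFunctor := hfin
  have : T.forget.IsCardinalAccessible Cardinal.aleph0.{v} := by
    refine Functor.IsFinitelyAccessible_iff_preservesFilteredColimitsOfSize.2 ⟨fun J _ _ => ?_⟩
    have : PreservesColimitsOfShape J T.toFunctor :=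
      PreservesFilteredColimitsOfSize.preserves_filtered_colimits J
    infer_instance
  exact T.adj.isCardinalPresentable_leftAdjoint_obj Cardinal.aleph0 X

theorem algebra_hom_ext {A B : T.Algebra} {x y : A ⟶ B}
    (h : ∀ (P : C) (t : T.free.obj P ⟶ A), IsFinitelyPresentable.{v} P → t ≫ x = t ≫ y) :
    x = y := by
  ext
  exact hom_ext_finitelyPresentable fun P t hP => freeLift_hom_ext (h P (freeLift t) hP)

/-- Free algebras on finitely presentable objects detect equality, and two maps from one that agree
in the colimit already agree at a stage, reached along a monomorphism. -/
theorem mono_ι_of_isColimit (hfin : IsFinitaryMonad T) {J : Type v} [SmallCategory J]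
    [IsFiltered J] {D : J ⥤ T.Algebra} (hD : ∀ ⦃i j : J⦄ (h : i ⟶ j), Mono (D.map h))
    {c : Cocone D} (hc : IsColimit c) (j : J) : Mono (c.ι.app j) := by
  refine ⟨fun x y hxy => algebra_hom_ext fun P t hP => ?_⟩
  have := isFinitelyPresentable_free hfin P
  obtain ⟨k, u, hu⟩ := exists_eq_of_preservesColimit_coyoneda_self hc (t ≫ x) (t ≫ y)
    (by rw [Category.assoc, Category.assoc, hxy])
  have := hD u
  exact (cancel_mono (D.map u)).1 hu

theorem isFinitelyGeneratedObject_of_isFinitelyPresentable {D : Type*} [Category.{v} D] (X : D)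
    [IsFinitelyPresentable.{v} X] : IsFinitelyGeneratedObject X := by
  intro J _ _ F _
  have : PreservesColimitsOfShape J (coyoneda.obj (Opposite.op X)) :=
    PreservesFilteredColimitsOfSize.preserves_filtered_colimits J
  infer_instance

/-- A factorization of `e ≫ x` through a stage descends along `e` by diagonal fill-in, because the
colimit injection is monic. -/
theorem isFinitelyGeneratedObject_of_strongEpi_f (hfin : IsFinitaryMonad T) {A B : T.Algebra}
    (e : A ⟶ B) [StrongEpi e.f] (hA : IsFinitelyGeneratedObject A) :
    IsFinitelyGeneratedObject B := by
  intro J _ _ D hD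
  have := hA J D hD
  have : Epi e := T.algebra_epi_of_epi e
  refine ⟨fun {c} hc => ⟨Types.FilteredColimit.isColimitOf _ _ (fun x => ?_)
    fun i j x y hxy => ?_⟩⟩
  · change B ⟶ c.pt at x
    obtain ⟨j, g, hg⟩ := exists_hom_of_preservesColimit_coyoneda hc (e ≫ x)
    have := mono_ι_of_isColimit hfin hD hc j
    obtain ⟨d, hd⟩ := exists_algebra_lift e (c.ι.app j) g x hg
    exact ⟨j, d, hd.symm⟩
  · change B ⟶ D.obj i at x
    change B ⟶ D.obj j at y
    have hxy' : x ≫ c.ι.app i = y ≫ c.ι.app j := hxy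
    obtain ⟨k, u, v, h⟩ := exists_eq_of_preservesColimit_coyoneda hc (e ≫ x) (e ≫ y)
      (by rw [Category.assoc, Category.assoc, hxy'])
    rw [Category.assoc, Category.assoc, cancel_epi] at h
    exact ⟨k, u, v, h⟩

/-- A finitely generated algebra is a regular quotient of a free algebra on a finitely presentable
object. -/
theorem exists_cover_of_isFinitelyGeneratedObject (hC : HasRegularFactorizations C)
    (hfin : IsFinitaryMonad T) (hreg : IsRegularMonad T) {A : T.Algebra}
    (hA : IsFinitelyGeneratedObject A) :
    ∃ (X : C) (q : T.free.obj X ⟶ A), IsFinitelyPresentable.{v} X ∧ IsRegularEpi q.f := by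
  obtain ⟨J, _, _, p, hp⟩ := exists_finitelyPresentable_presentation A.A
  let t (j : J) : T.free.obj (p.diag.obj j) ⟶ A := freeLift (p.ι.app j)
  have ht {i j : J} (w : i ⟶ j) : T.free.map (p.diag.map w) ≫ t j = t i :=
    (free_map_freeLift _ _).trans (congrArg freeLift (p.w w))
  choose I e m he hm hem using fun j => exists_algebra_factorization hC hreg (t j)
  have hs {i j : J} (w : i ⟶ j) : ∃ s : I i ⟶ I j, s ≫ m j = m i :=
    exists_algebra_lift (e i) (m j) (T.free.map (p.diag.map w) ≫ e j) (m i)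
      (by rw [Category.assoc, hem, hem, ht])
  choose s hs using @hs
  let S : J ⥤ T.Algebra :=
    { obj := I
      map := s
      map_id := fun j => by rw [← cancel_mono (m j), hs, Category.id_comp]
      map_comp := fun {i j k} w x => by
        rw [← cancel_mono (m k), hs, Category.assoc, hs, hs] }
  let c : Cocone S :=
    { pt := A
      ι := { app := m, naturality := fun i j w => (hs w).trans (Category.comp_id _).symm } }
  have hS : ∀ ⦃i j : J⦄ (h : i ⟶ j), Mono (S.map h) := fun i j h =>
    have : Mono (s h ≫ m j) := by rw [hs]; exact hm i
    mono_of_mono (s h) (m j)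
  have := hasColimits_of_isLocallyFinitelyPresentable C
  have : PreservesFilteredColimitsOfSize.{v, v} T.toFunctor := hfin
  have : PreservesColimitsOfShape J T.toFunctor :=
    PreservesFilteredColimitsOfSize.preserves_filtered_colimits J
  obtain ⟨hc⟩ := isColimit_of_mono_of_presentation p (S ⋙ T.forget) (T.forget.mapCocone c).ι
    (fun j => mono_f (m j)) (fun j => freeRestrict (e j)) (fun j =>
      (freeRestrict_comp (e j) (m j)).symm.trans
        ((congrArg freeRestrict (hem j)).trans (freeRestrict_freeLift _)))
  have hc' : IsColimit c := isColimitOfReflects T.forget hc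
  have := hA J S hS
  -- The identity factors through some image, so that subalgebra is all of `A`.
  obtain ⟨j, d, hd⟩ := exists_hom_of_preservesColimit_coyoneda hc' (𝟙 A)
  have : IsSplitEpi (m j) := ⟨⟨⟨d, hd⟩⟩⟩
  have : IsIso (m j) := isIso_of_mono_of_isSplitEpi _
  have : IsIso (m j).f := Functor.map_isIso T.forget (m j)
  refine ⟨_, t j, hp j, ?_⟩
  rw [← hem]
  exact (MorphismProperty.cancel_right_of_respectsIso (MorphismProperty.regularEpi C)
    (e j).f (m j).f).2 (he j)

theorem isFinitelyPresentable_of_isCoequalizer {D : Type*} [Category.{v} D] {X Y Z : D}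
    {f g : X ⟶ Y} {q : Y ⟶ Z} (h : IsCoequalizer f g q) [IsFinitelyPresentable.{v} X]
    [IsFinitelyPresentable.{v} Y] : IsFinitelyPresentable.{v} Z := by
  obtain ⟨w, ⟨hq⟩⟩ := h
  have : ∀ k, IsCardinalPresentable ((parallelPair f g).obj k) Cardinal.aleph0.{v} := by
    rintro (_ | _) <;> assumption
  exact isCardinalPresentable_of_isColimit _ hq Cardinal.aleph0.{v} (by
    rw [hasCardinalLT_aleph0_iff]
    infer_instance)

/-- Over a filtered diagram of parallel pairs into a finitely presentable object, a finitely
presentable coequalizer is the coequalizer of one of the pairs. -/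
theorem exists_coequalizer_of_filtered {D : Type*} [Category.{v} D] [HasProducts.{v} D]
    {J : Type v} [SmallCategory J] [IsFiltered J] [HasColimitsOfShape J D] {F : J ⥤ D}
    {K X A : D} (t : F ⟶ (Functor.const J).obj K)
    (ht : ∀ {W : D} {x y : K ⟶ W}, (∀ j, t.app j ≫ x = t.app j ≫ y) → x = y)
    {l r : K ⟶ X} {q : X ⟶ A} (hq : IsCoequalizer l r q) [IsFinitelyPresentable.{v} X]
    [IsFinitelyPresentable.{v} A] : ∃ j, IsCoequalizer (t.app j ≫ l) (t.app j ≫ r) q := by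
  have htw {i j : J} (u : i ⟶ j) : F.map u ≫ t.app j = t.app i := by simp
  suffices ∃ j, ∀ (W : D) (k : X ⟶ W),
      (t.app j ≫ l) ≫ k = (t.app j ≫ r) ≫ k → l ≫ k = r ≫ k by
    obtain ⟨j, hj⟩ := this
    exact ⟨j, hq.of_iff fun k => ⟨hj _ k, fun hk => by simp [hk]⟩⟩
  -- If each stage `j` fails, some `h j` coequalizes its pair but not `l, r`. Collect these
  -- witnesses in products over the arrows out of `j`, and pass to the colimit.
  by_contra! H
  choose Z h hh hne using H
  let Q (j : J) (p : Σ k, (j ⟶ k)) : D := Z p.1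
  have hπ (j k : J) {a b : j ⟶ k} (hab : a = b) : Pi.π (Q j) ⟨k, a⟩ = Pi.π (Q j) ⟨k, b⟩ := by
    rw [hab]
  let P : J ⥤ D :=
    { obj := fun j => ∏ᶜ Q j
      map := fun {i j} u => Pi.lift fun p => Pi.π (Q i) ⟨p.1, u ≫ p.2⟩
      map_id := fun j => Pi.hom_ext _ _ fun p => by
        refine (Pi.lift_π _ _).trans (Eq.trans ?_ (Category.id_comp _).symm)
        exact hπ j p.1 (Category.id_comp p.2)
      map_comp := fun {i j k} u w => Pi.hom_ext _ _ fun p => by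
        rw [Category.assoc, Pi.lift_π, Pi.lift_π]
        refine (hπ i p.1 (Category.assoc u w p.2)).trans (Eq.symm ?_)
        exact Pi.lift_π _ _ }
  let H (j : J) : X ⟶ P.obj j := Pi.lift fun p => h p.1
  have hHπ (j : J) (p : Σ k, (j ⟶ k)) : H j ≫ Pi.π (Q j) p = h p.1 := Pi.lift_π _ _
  have hH {i j : J} (u : i ⟶ j) : H i ≫ P.map u = H j := Pi.hom_ext _ _ fun p => by
    rw [Category.assoc, Pi.lift_π, hHπ, hHπ]
  have hc (i j : J) : H i ≫ colimit.ι P i = H j ≫ colimit.ι P j := by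
    obtain ⟨k, u, w, -⟩ := IsFilteredOrEmpty.cocone_objs i j
    rw [← colimit.w P u, ← colimit.w P w, reassoc_of% hH, reassoc_of% hH]
  obtain ⟨i⟩ := IsFiltered.nonempty (C := J)
  have hi : l ≫ H i ≫ colimit.ι P i = r ≫ H i ≫ colimit.ι P i := by
    refine ht fun j => ?_
    have hj : (t.app j ≫ l) ≫ H j = (t.app j ≫ r) ≫ H j := Pi.hom_ext _ _ fun p => by
      have := hh p.1
      rw [Category.assoc, Category.assoc] at this
      rw [Category.assoc, Category.assoc, Category.assoc, Category.assoc, hHπ, ← htw p.2,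
        Category.assoc, Category.assoc, this]
    rw [hc i j]
    simpa using hj =≫ colimit.ι P j
  -- Finite presentability of `A`, then of `X`, brings the factorization through `q` down to a stage
  -- `k`; the component at `𝟙 k` makes `h k` coequalize `l, r`.
  obtain ⟨d, hd⟩ := hq.exists_desc _ hi
  obtain ⟨j, d', hd'⟩ := IsFinitelyPresentable.exists_hom_of_isColimit (colimit.isColimit P) d
  obtain ⟨k, u, w, huw⟩ := IsFinitelyPresentable.exists_eq_of_isColimit (colimit.isColimit P)
    (q ≫ d') (H i) (by rw [Category.assoc, hd', hd]; rfl)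
  rw [hH, Category.assoc] at huw
  refine hne k ?_
  rw [← hHπ k ⟨k, 𝟙 k⟩, ← huw, Category.assoc]
  have := hq.1
  simp only [← Category.assoc] at this ⊢
  rw [this]

end FinitaryMonad

end RegularMonadAlgebras

open RegularMonadAlgebras

theorem theorem3p7 {C : Type u} [Category.{v} C] [IsLocallyFinitelyPresentable.{v} C]
    (hC : RegularMonadAlgebras.HasRegularFactorizations C)
    (T : Monad C) (hfin : RegularMonadAlgebras.IsFinitaryMonad T)
    (hreg : RegularMonadAlgebras.IsRegularMonad T) (A : T.Algebra) :
    List.TFAE [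
      ∃ (X : C) (K : T.Algebra) (l r : K ⟶ (Monad.free T).obj X) (q : (Monad.free T).obj X ⟶ A),
        IsFinitelyPresentable.{v} X ∧
          RegularMonadAlgebras.IsFinitelyGeneratedCongruence l r ∧
          RegularMonadAlgebras.IsCoequalizer l r q,
      ∃ (X Y : C) (f g : (Monad.free T).obj Y ⟶ (Monad.free T).obj X)
        (e : (Monad.free T).obj X ⟶ A),
        IsFinitelyPresentable.{v} X ∧ IsFinitelyPresentable.{v} Y ∧
          RegularMonadAlgebras.IsCoequalizer f g e,
      IsFinitelyPresentable.{v} A] := by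
  have := hasLimits_algebra (T := T)
  tfae_have 1 → 2 := by
    rintro ⟨X, K, l, r, q, hX, ⟨-, K', m, hK', -, B, q', hq', hm⟩, hq⟩
    obtain ⟨Y, p, hY, hp⟩ := exists_cover_of_isFinitelyGeneratedObject hC hfin hreg hK'
    have : Epi p := T.algebra_epi_of_epi p
    refine ⟨X, Y, p ≫ m ≫ l, p ≫ m ≫ r, q, hX, hY, hq.of_iff fun k => ?_⟩
    simp only [Category.assoc, cancel_epi]
    refine ⟨fun hk => ?_, fun hk => by rw [hk]⟩
    -- `q'` is the coequalizer of both pairs, so factoring through it transfers the equation to `l,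
    -- r`.
    obtain ⟨d, rfl⟩ := hm.exists_desc k (by simpa only [Category.assoc] using hk)
    have := hq'.1
    rw [reassoc_of% this]
  tfae_have 2 → 1 := by
    rintro ⟨X, Y, f, g, e, hX, hY, he⟩
    have := isFinitelyPresentable_free hfin Y
    have hK : IsKernelPair e (pullback.fst e e) (pullback.snd e e) := IsPullback.of_hasPullback e e
    obtain ⟨K', p, m, hp, hm, hpm⟩ := exists_algebra_factorization hC hreg (hK.lift f g he.1)
    have : Epi p := T.algebra_epi_of_epi p
    have hl := isCoequalizer_of_isKernelPair he hK
    refine ⟨X, _, _, _, e, hX, ⟨⟨A, e, hK⟩, K', m, ?_, hm, A, e, hl, he.of_iff fun k => ?_⟩, hl⟩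
    · exact isFinitelyGeneratedObject_of_strongEpi_f hfin p
        (isFinitelyGeneratedObject_of_isFinitelyPresentable _)
    · rw [← cancel_epi p, ← Category.assoc, ← Category.assoc, ← Category.assoc, ← Category.assoc,
        hpm, hK.lift_fst, hK.lift_snd]
  tfae_have 2 → 3 := by
    rintro ⟨X, Y, f, g, e, hX, hY, he⟩
    have := isFinitelyPresentable_free hfin X
    have := isFinitelyPresentable_free hfin Y
    exact isFinitelyPresentable_of_isCoequalizer he
  tfae_have 3 → 2 := by
    intro hA
    obtain ⟨X, q, hX, hq⟩ := exists_cover_of_isFinitelyGeneratedObject hC hfin hreg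
      (isFinitelyGeneratedObject_of_isFinitelyPresentable A)
    have := isFinitelyPresentable_free hfin X
    have hK := IsPullback.of_hasPullback q q
    obtain ⟨J, _, _, p, hp⟩ := exists_finitelyPresentable_presentation (pullback q q).A
    have := hasFilteredColimits_algebra hfin J
    let t : p.diag ⋙ T.free ⟶ (Functor.const J).obj (pullback q q) :=
      { app := fun j => freeLift (A := pullback q q) (p.ι.app j)
        naturality := fun i j w => ((free_map_freeLift _ _).trans
          (congrArg freeLift (p.w w))).trans (Category.comp_id _).symm }
    obtain ⟨j, hj⟩ := exists_coequalizer_of_filtered t (fun {W x y} h => by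
      ext
      exact p.isColimit.hom_ext fun j => freeLift_hom_ext (h j))
      (isCoequalizer_of_isRegularEpi_f hreg q hK)
    exact ⟨X, _, _, _, q, hX, hp j, hj⟩
  tfae_finish
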